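/- Let $d\ge 1$, let $G\subset\mathbb{R}^d$ be a bounded Borel measurable set, and let $\pi$ be a probability measure on $(G,\mathcal{B}(G))$, where $\mathcal{B}(G)$ is the Borel $\sigma$-algebra of $G$, which is absolutely continuous with respect to the Lebesgue measure (restricted to $G$). Let $$\mathscr{B}=\{(-\infty,x)_G \mid x\in\mathbb{R}^d\},\qquad (-\infty,x)_G=\Big(\prod_{i=1}^d(-\infty,x_i)\Big)\cap G .$$ A finite set $\Gamma_\delta\subseteq\mathcal{B}(G)$ with $\emptyset\in\Gamma_\delta$ is called a $\delta$-cover of $\mathscr{B}$ with respect to $\pi$ if for every $A\in\mathscr{B}$ there are $C,D\in\Gamma_\delta$ such that $C\subseteq A\subseteq D$ and $\pi(D\setminus C)\le\delta$. For $0<\varepsilon<1$ let $$C_{\varepsilon,d}=\max_{x\ge1}\frac{(2+\log_2x)^{(3d+1)/2}}{x^{\varepsilon}}=4^{\varepsilon}\left(\frac{3d+1}{2\mathrm{e}\,\varepsilon\log 2}\right)^{(3d+1)/2},$$ where $\log$ is the natural logarithm (the maximum is attained and has the stated value). Then for all $0<\delta\le1$ and $0<\varepsilon<1$ there is a $\delta$-cover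 $\Gamma_\delta$ of $\mathscr{B}$ with respect to $\pi$ with $$|\Gamma_\delta|\le\left(2+\left\lceil(2C_{\varepsilon,d}\,\delta^{-1})^{1/(1-\varepsilon)}\right\rceil\right)^d .$$ -/

import Mathlib

open MeasureTheory Set

/-- A finite family `Γ` of measurable sets, containing `∅`, is a `δ`-cover of the family `𝒜` of
test sets with respect to `π` if every test set `A` is bracketed by some `C, D ∈ Γ` with
`C ⊆ A ⊆ D` and `π (D \ C) ≤ δ`. -/
structure IsDeltaCover {X : Type*} [MeasurableSpace X] (π : Measure X) (𝒜 : Set (Set X)) (δ : ℝ)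
    (Γ : Finset (Set X)) : Prop where
  measurableSet : ∀ C ∈ Γ, MeasurableSet C
  empty_mem : ∅ ∈ Γ
  exists_bracket : ∀ A ∈ 𝒜, ∃ C ∈ Γ, ∃ D ∈ Γ, C ⊆ A ∧ A ⊆ D ∧ π (D \ C) ≤ ENNReal.ofReal δ

/-- The box `(-∞, x)_G = (∏ i, (-∞, x i)) ∩ G`, as a subset of the state space `G`. -/
def anchoredBox {d : ℕ} (G : Set (Fin d → ℝ)) (x : Fin d → ℝ) : Set G :=
  {y : G | ∀ i, (y : Fin d → ℝ) i < x i}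

/-- The family of all boxes `(-∞, x)_G`, `x ∈ ℝ^d`. -/
def anchoredBoxes {d : ℕ} (G : Set (Fin d → ℝ)) : Set (Set G) :=
  Set.range (anchoredBox G)

/-- The constant `C_{ε,d} = 4^ε ((3d+1) / (2 e ε log 2))^((3d+1)/2)`. -/
noncomputable def coverConst (ε : ℝ) (d : ℕ) : ℝ :=
  (4 : ℝ) ^ ε *
    ((3 * (d : ℝ) + 1) / (2 * Real.exp 1 * ε * Real.log 2)) ^ ((3 * (d : ℝ) + 1) / 2)

/-! Hyperplanes are Lebesgue null, so each coordinate has an atomless law under `π`, and its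
quantiles cut a bounded interval into `k` pieces of mass at most `1 / k`. Boxes with corners on the
quantile grid bracket every box: the gap between two neighbouring grid boxes lies in `d` slabs, so
its mass is at most `d / k`. This uses `(k + 1) ^ d` sets. The constant enters only through `d ≤
coverConst ε d`, which makes `k = m + 1` large enough, `m` being the ceiling in the bound. -/

/-- For positive `a`, `c`, the function `t ↦ t ^ a * exp (-c t)` is at most its value at `a / c`. -/
lemma rpow_le_mul_exp_of_pos {a c t : ℝ} (ha : 0 < a) (hc : 0 < c) (ht : 0 ≤ t) :
    t ^ a ≤ (a / (Real.exp 1 * c)) ^ a * Real.exp (c * t) := by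
  -- This is `1 + u ≤ exp u` at `u = c * t / a - 1`.
  have h1 : c * t / a ≤ Real.exp (c * t / a) / Real.exp 1 := by
    rw [← Real.exp_sub]
    linarith [Real.add_one_le_exp (c * t / a - 1)]
  have h2 : t ≤ a / (Real.exp 1 * c) * Real.exp (c * t / a) := by
    calc t = a / c * (c * t / a) := by field_simp
      _ ≤ a / c * (Real.exp (c * t / a) / Real.exp 1) := by gcongr
      _ = _ := by field_simp
  calc t ^ a ≤ (a / (Real.exp 1 * c) * Real.exp (c * t / a)) ^ a :=
        Real.rpow_le_rpow ht h2 ha.le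
    _ = _ := by
        rw [Real.mul_rpow (by positivity) (Real.exp_pos _).le, ← Real.exp_mul]
        congr 2
        field_simp

lemma coverConst_eq (ε : ℝ) (d : ℕ) :
    coverConst ε d = (4 : ℝ) ^ ε *
      ((3 * (d : ℝ) + 1) / 2 / (Real.exp 1 * (ε * Real.log 2))) ^ ((3 * (d : ℝ) + 1) / 2) := by
  unfold coverConst
  congr 2
  rw [div_div]
  congr 1
  ring

/-- Substituting `t = 2 + log₂ x` in `x ^ ε`. -/
lemma four_rpow_mul_rpow {ε x : ℝ} (hx : 0 < x) :
    (4 : ℝ) ^ ε * x ^ ε = Real.exp (ε * Real.log 2 * (2 + Real.logb 2 x)) := by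
  have h2 : Real.log 2 ≠ 0 := (Real.log_pos one_lt_two).ne'
  have h4 : Real.log 4 = 2 * Real.log 2 := by
    rw [show (4 : ℝ) = 2 ^ 2 by norm_num, Real.log_pow]
    norm_num
  rw [Real.rpow_def_of_pos (by norm_num), Real.rpow_def_of_pos hx, ← Real.exp_add, h4, Real.logb]
  congr 1
  field_simp

theorem isGreatest_coverConst {d : ℕ} (hd : 1 ≤ d) {ε : ℝ} (hε0 : 0 < ε) (hε1 : ε < 1) :
    IsGreatest
      ((fun x : ℝ => (2 + Real.logb 2 x) ^ ((3 * (d : ℝ) + 1) / 2) / x ^ ε) '' Set.Ici 1)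
      (coverConst ε d) := by
  have hd' : (1 : ℝ) ≤ d := by exact_mod_cast hd
  have hl : 0 < Real.log 2 := Real.log_pos one_lt_two
  have hl1 : Real.log 2 < 1 := by linarith [Real.log_two_lt_d9]
  rw [coverConst_eq]
  set a : ℝ := (3 * (d : ℝ) + 1) / 2 with ha
  have ha2 : 2 ≤ a := by linarith
  set c : ℝ := ε * Real.log 2 with hc
  have hc0 : 0 < c := by positivity
  have hc1 : c ≤ 1 := by nlinarith
  constructor
  -- The critical point is `2 + logb 2 x = a / c`; it lies in `x ≥ 1` because `a ≥ 2` and `c ≤ 1`.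
  · refine ⟨2 ^ (a / c - 2), ?_, ?_⟩
    · apply Real.one_le_rpow one_le_two
      have : 2 ≤ a / c := by rw [le_div_iff₀ hc0]; linarith
      linarith
    · have hx : (0 : ℝ) < 2 ^ (a / c - 2) := by positivity
      have h := four_rpow_mul_rpow (ε := ε) hx
      have hlog : Real.logb 2 ((2 : ℝ) ^ (a / c - 2)) = a / c - 2 :=
        Real.logb_rpow (by norm_num) (by norm_num)
      simp only
      rw [hlog] at h ⊢
      rw [div_eq_iff (by positivity), mul_right_comm, h, ← hc]
      have e1 : c * (2 + (a / c - 2)) = 1 * a := by field_simp; ring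
      rw [e1, Real.exp_mul, ← Real.mul_rpow (Real.exp_pos _).le (by positivity)]
      congr 1
      field_simp
      ring
  · rintro _ ⟨x, hx, rfl⟩
    have hx1 : (1 : ℝ) ≤ x := hx
    have hx0 : 0 < x := by linarith
    have ht : 0 ≤ Real.logb 2 x := Real.logb_nonneg one_lt_two hx1
    simp only
    rw [div_le_iff₀ (by positivity), mul_right_comm, four_rpow_mul_rpow hx0, mul_comm]
    exact rpow_le_mul_exp_of_pos (by linarith) hc0 (by linarith)

/-- The maximum dominates the value at `x = 1`, which is `2 ^ ((3d+1)/2) ≥ 2 ^ d ≥ d`. -/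
lemma natCast_le_coverConst {d : ℕ} (hd : 1 ≤ d) {ε : ℝ} (hε0 : 0 < ε) (hε1 : ε < 1) :
    (d : ℝ) ≤ coverConst ε d := by
  have h := (isGreatest_coverConst hd hε0 hε1).2 ⟨1, Set.self_mem_Ici, rfl⟩
  simp only [Real.logb_one, add_zero, Real.one_rpow, div_one] at h
  refine le_trans ?_ h
  calc (d : ℝ) ≤ (2 : ℝ) ^ d := by exact_mod_cast (Nat.lt_two_pow_self).le
    _ = (2 : ℝ) ^ (d : ℝ) := (Real.rpow_natCast _ _).symm
    _ ≤ _ := by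
      apply Real.rpow_le_rpow_of_exponent_le one_le_two
      have : (0 : ℝ) ≤ d := by positivity
      linarith

/-- The jump of the cdf at a point is the mass of that point. -/
lemma continuous_cdf (μ : Measure ℝ) [IsProbabilityMeasure μ] [NullSingletonClass μ] :
    Continuous (ProbabilityTheory.cdf μ) := by
  rw [continuous_iff_continuousAt]
  intro x
  rw [(ProbabilityTheory.cdf μ).mono.continuousAt_iff_leftLim_eq_rightLim,
    StieltjesFunction.rightLim_eq]
  have h := (ProbabilityTheory.cdf μ).measure_singleton x
  rw [ProbabilityTheory.measure_cdf, measure_singleton] at h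
  have h' := ENNReal.ofReal_eq_zero.1 h.symm
  exact le_antisymm ((ProbabilityTheory.cdf μ).mono.leftLim_le le_rfl) (by linarith)

/-- An atomless probability measure concentrated on a bounded interval has quantiles
`-R = t 0, …, t k = R` cutting it into pieces of mass `1 / k`. -/
lemma exists_quantiles (μ : Measure ℝ) [IsProbabilityMeasure μ] [NullSingletonClass μ] {R : ℝ}
    (hR : 0 ≤ R) (hμ : μ (Ioo (-R) R) = 1) {k : ℕ} (hk : 0 < k) :
    ∃ t : ℕ → ℝ, t 0 = -R ∧ t k = R ∧
      ∀ j < k, μ (Ico (t j) (t (j + 1))) ≤ ENNReal.ofReal (1 / k) := by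
  set F := ProbabilityTheory.cdf μ with hF
  have hcont : Continuous F := continuous_cdf μ
  have hR1 : F R = 1 := by
    rw [hF, ProbabilityTheory.cdf_eq_real, measureReal_def]
    have : μ (Iic R) = 1 :=
      le_antisymm prob_le_one (hμ ▸ measure_mono (fun y hy => hy.2.le))
    simp [this]
  have hR0 : F (-R) = 0 := by
    rw [hF, ProbabilityTheory.cdf_eq_real, measureReal_def]
    have h0 : μ (Ioo (-R) R)ᶜ = 0 := (prob_compl_eq_zero_iff measurableSet_Ioo).2 hμ
    have hsub : Iic (-R) ⊆ (Ioo (-R) R)ᶜ := fun y hy hy' => absurd hy'.1 (not_lt.2 hy)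
    have : μ (Iic (-R)) = 0 := measure_mono_null hsub h0
    simp [this]
  have hk' : (0 : ℝ) < k := by exact_mod_cast hk
  -- The end quantiles are pinned to `-R` and `R`, since the cdf may take the values 0 and 1
  -- elsewhere too. Indices beyond `k` get a dummy value.
  have hq : ∀ j : ℕ, ∃ s, (j = 0 → s = -R) ∧ (j = k → s = R) ∧ (j ≤ k → F s = j / k) := by
    intro j
    rcases Nat.eq_zero_or_pos j with rfl | hj
    · exact ⟨-R, fun _ => rfl, fun h => absurd h hk.ne, fun _ => by simp [hR0]⟩
    rcases eq_or_ne j k with rfl | hjk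
    · exact ⟨R, fun h => absurd h hj.ne', fun _ => rfl, fun _ => by rw [hR1, div_self hk'.ne']⟩
    by_cases hle : j ≤ k
    · have hmem : (j : ℝ) / k ∈ Icc (F (-R)) (F R) := by
        rw [hR0, hR1]
        exact ⟨by positivity, (div_le_one hk').2 (by exact_mod_cast hle)⟩
      obtain ⟨s, -, hs⟩ := intermediate_value_Icc (by linarith) hcont.continuousOn hmem
      exact ⟨s, fun h => absurd h hj.ne', fun h => absurd h hjk, fun _ => hs⟩
    · exact ⟨0, fun h => absurd h hj.ne', fun h => absurd h hjk, fun h => absurd h hle⟩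
  choose t ht0 htk ht using hq
  refine ⟨t, ht0 0 rfl, htk k rfl, fun j hj => ?_⟩
  have hμF : μ = F.measure := (ProbabilityTheory.measure_cdf μ).symm
  rw [measure_congr (Ico_ae_eq_Ioc (μ := μ)), hμF, StieltjesFunction.measure_Ioc,
    ht j hj.le, ht (j + 1) hj]
  apply ENNReal.ofReal_le_ofReal
  push_cast
  rw [← sub_div, add_sub_cancel_left]

lemma anchoredBox_mono {d : ℕ} {G : Set (Fin d → ℝ)} {x x' : Fin d → ℝ} (h : ∀ i, x i ≤ x' i) :
    anchoredBox G x ⊆ anchoredBox G x' :=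
  fun _ hy i => (hy i).trans_le (h i)

lemma measurableSet_anchoredBox {d : ℕ} (G : Set (Fin d → ℝ)) (x : Fin d → ℝ) :
    MeasurableSet (anchoredBox G x) := by
  unfold anchoredBox
  rw [Set.ofPred_forall]
  exact MeasurableSet.iInter fun i =>
    measurableSet_lt ((measurable_pi_apply i).comp measurable_subtype_coe) measurable_const

/-- A point of the difference violates some constraint `y i < x i`, hence lies in the slab `x i ≤ y
i < x' i`. -/
lemma measure_anchoredBox_diff_le {d : ℕ} {G : Set (Fin d → ℝ)} (π : Measure G)
    (x x' : Fin d → ℝ) :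
    π (anchoredBox G x' \ anchoredBox G x) ≤
      ∑ i, π.map (fun y : G => (y : Fin d → ℝ) i) (Ico (x i) (x' i)) := by
  have hsub : anchoredBox G x' \ anchoredBox G x ⊆
      ⋃ i, (fun y : G => (y : Fin d → ℝ) i) ⁻¹' Ico (x i) (x' i) := by
    rintro y ⟨hy', hy⟩
    obtain ⟨i, hi⟩ := not_forall.1 hy
    exact mem_iUnion.2 ⟨i, not_lt.1 hi, hy' i⟩
  refine (measure_mono hsub).trans ((measure_iUnion_fintype_le _ _).trans_eq ?_)
  refine Finset.sum_congr rfl fun i _ => (Measure.map_apply ?_ measurableSet_Ico).symm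
  exact (measurable_pi_apply i).comp measurable_subtype_coe

lemma nullSingletonClass_map_coord {d : ℕ} {G : Set (Fin d → ℝ)} (hGm : MeasurableSet G) {π : Measure G}
    (hπ : π ≪ (volume : Measure (Fin d → ℝ)).comap (Subtype.val : G → (Fin d → ℝ))) (i : Fin d) :
    NullSingletonClass (π.map (fun y : G => (y : Fin d → ℝ) i)) := by
  refine ⟨fun a => ?_⟩
  have hmeas : Measurable (fun y : G => (y : Fin d → ℝ) i) :=
    (measurable_pi_apply i).comp measurable_subtype_coe
  rw [Measure.map_apply hmeas (measurableSet_singleton a)]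
  apply hπ
  rw [(MeasurableEmbedding.subtype_coe hGm).comap_apply]
  refine measure_mono_null (t := {y : Fin d → ℝ | y i = a}) ?_ ?_
  · rintro _ ⟨y, hy, rfl⟩
    exact hy
  · exact Measure.pi_hyperplane (fun _ : Fin d => (volume : Measure ℝ)) i a

/-- A finite sequence from `t 0 ≤ x` to `t k ≥ x` has a step straddling `x`. -/
lemma exists_step_straddling {t : ℕ → ℝ} {k : ℕ} (hk : 0 < k) {x : ℝ} (h0 : t 0 ≤ x)
    (h1 : x ≤ t k) : ∃ j < k, t j ≤ x ∧ x ≤ t (j + 1) := by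
  by_contra! h
  -- Without a straddling step, `t j ≤ x` propagates up to `k - 1` and then forces `t k < x`.
  -- Monotonicity of `t` is not needed.
  have : ∀ j, j < k → t j ≤ x := by
    intro j
    induction j with
    | zero => exact fun _ => h0
    | succ j ih => exact fun hj => (h j (by omega) (ih (by omega))).le
  have h2 := h (k - 1) (by omega) (this (k - 1) (by omega))
  rw [Nat.sub_add_cancel hk] at h2
  linarith

/-- The grid of marginal `1 / k`-quantiles yields a cover with `(k + 1) ^ d` sets. -/
theorem exists_isDeltaCover_card_le {d : ℕ} (hd : 1 ≤ d) {G : Set (Fin d → ℝ)}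
    (hGb : Bornology.IsBounded G) (hGm : MeasurableSet G) (π : Measure G) [IsProbabilityMeasure π]
    (hπ : π ≪ (volume : Measure (Fin d → ℝ)).comap (Subtype.val : G → (Fin d → ℝ)))
    {δ : ℝ} {k : ℕ} (hk : 0 < k) (hδ : d / k ≤ δ) :
    ∃ Γ : Finset (Set G), IsDeltaCover π (anchoredBoxes G) δ Γ ∧ Γ.card ≤ (k + 1) ^ d := by
  classical
  obtain ⟨R, hR, hGR⟩ := hGb.exists_pos_norm_lt
  have hGi : ∀ (y : G) (i : Fin d), (y : Fin d → ℝ) i ∈ Ioo (-R) R := fun y i =>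
    abs_lt.1 ((norm_le_pi_norm (y : Fin d → ℝ) i).trans_lt (hGR y y.2))
  have hmeas : ∀ i, Measurable (fun y : G => (y : Fin d → ℝ) i) := fun i =>
    (measurable_pi_apply i).comp measurable_subtype_coe
  have hq : ∀ i : Fin d, ∃ t : ℕ → ℝ, t 0 = -R ∧ t k = R ∧ ∀ j < k,
      π.map (fun y : G => (y : Fin d → ℝ) i) (Ico (t j) (t (j + 1))) ≤
        ENNReal.ofReal (1 / k) := by
    intro i
    have := nullSingletonClass_map_coord hGm hπ i
    have := Measure.isProbabilityMeasure_map (μ := π) (hmeas i).aemeasurable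
    refine exists_quantiles _ hR.le ?_ hk
    have huniv : (fun y : G => (y : Fin d → ℝ) i) ⁻¹' Ioo (-R) R = univ :=
      Set.eq_univ_of_forall fun y => hGi y i
    rw [Measure.map_apply (hmeas i) measurableSet_Ioo, huniv, measure_univ]
  choose t ht0 htk ht using hq
  let box : (Fin d → Fin (k + 1)) → Set G := fun J => anchoredBox G fun i => t i (J i)
  refine ⟨Finset.univ.image box, ⟨?_, ?_, ?_⟩, ?_⟩
  · intro C hC
    obtain ⟨J, -, rfl⟩ := Finset.mem_image.1 hC
    exact measurableSet_anchoredBox _ _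
  -- The corner `(-R, …, -R)` gives the empty box, as `d ≥ 1` supplies a coordinate.
  · refine Finset.mem_image.2 ⟨fun _ => 0, Finset.mem_univ _, ?_⟩
    refine Set.eq_empty_of_forall_notMem fun y hy => ?_
    have h := hy ⟨0, hd⟩
    simp only [Fin.val_zero, ht0] at h
    exact lt_asymm h (hGi y _).1
  · rintro _ ⟨x, rfl⟩
    -- Clamping the corner to `[-R, R]` leaves the box unchanged, because points of `G` have
    -- coordinates strictly inside.
    set z : Fin d → ℝ := fun i => max (-R) (min (x i) R) with hz
    have hxz : anchoredBox G x = anchoredBox G z := by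
      ext y
      refine forall_congr' fun i => ?_
      have := hGi y i
      simp [hz, this.2, not_lt.2 this.1.le]
    have hstep : ∀ i, ∃ j < k, t i j ≤ z i ∧ z i ≤ t i (j + 1) := fun i =>
      exists_step_straddling hk (by rw [ht0]; exact le_max_left _ _)
        (by rw [htk]; exact max_le (by linarith) (min_le_right _ _))
    choose j hjk hjl hju using hstep
    refine ⟨_, Finset.mem_image_of_mem box (Finset.mem_univ fun i => ⟨j i, by grind⟩),
      _, Finset.mem_image_of_mem box (Finset.mem_univ fun i => ⟨j i + 1, by grind⟩), ?_, ?_, ?_⟩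
    · rw [hxz]
      exact anchoredBox_mono hjl
    · rw [hxz]
      exact anchoredBox_mono hju
    · calc _ ≤ _ := measure_anchoredBox_diff_le π _ _
        _ ≤ ∑ _i : Fin d, ENNReal.ofReal (1 / k) :=
          Finset.sum_le_sum fun i _ => ht i (j i) (hjk i)
        _ = ENNReal.ofReal (d / k) := by
          rw [← ENNReal.ofReal_sum_of_nonneg (fun _ _ => by positivity)]
          simp [div_eq_mul_inv]
        _ ≤ _ := ENNReal.ofReal_le_ofReal hδ
  · exact Finset.card_image_le.trans (by simp)

theorem mainTheorem8 (d : ℕ) (hd : 1 ≤ d) (G : Set (Fin d → ℝ)) (hGb : Bornology.IsBounded G)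
    (hGm : MeasurableSet G) (π : Measure G) [IsProbabilityMeasure π]
    (hπ : π ≪ (volume : Measure (Fin d → ℝ)).comap (Subtype.val : G → (Fin d → ℝ)))
    (δ : ℝ) (hδ0 : 0 < δ) (hδ1 : δ ≤ 1) (ε : ℝ) (hε0 : 0 < ε) (hε1 : ε < 1) :
    IsGreatest
        ((fun x : ℝ => (2 + Real.logb 2 x) ^ ((3 * (d : ℝ) + 1) / 2) / x ^ ε) '' Set.Ici 1)
        (coverConst ε d) ∧
      ∃ Γ : Finset (Set G), IsDeltaCover π (anchoredBoxes G) δ Γ ∧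
        Γ.card ≤ (2 + ⌈(2 * coverConst ε d * δ⁻¹) ^ (1 / (1 - ε))⌉₊) ^ d := by
  refine ⟨isGreatest_coverConst hd hε0 hε1, ?_⟩
  set m : ℕ := ⌈(2 * coverConst ε d * δ⁻¹) ^ (1 / (1 - ε))⌉₊ with hm
  have hd' : (1 : ℝ) ≤ d := by exact_mod_cast hd
  have hC : (d : ℝ) ≤ coverConst ε d := natCast_le_coverConst hd hε0 hε1
  have hδ : 1 ≤ δ⁻¹ := (one_le_inv₀ hδ0).2 hδ1
  have hbase : d * δ⁻¹ ≤ 2 * coverConst ε d * δ⁻¹ := by gcongr; linarith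
  have hone : 1 ≤ 2 * coverConst ε d * δ⁻¹ := le_trans (by nlinarith) hbase
  have hexp : 1 ≤ 1 / (1 - ε) := by rw [le_div_iff₀ (by linarith)]; linarith
  -- The base is at least 1, so the exponent `1 / (1 - ε) ≥ 1` can only increase it.
  have hdm : d * δ⁻¹ ≤ m :=
    (hbase.trans (Real.self_le_rpow_of_one_le hone hexp)).trans (Nat.le_ceil _)
  have hdk : (d : ℝ) / (m + 1 : ℕ) ≤ δ := by
    rw [div_le_iff₀ (by positivity)]
    rw [← div_eq_mul_inv, div_le_iff₀ hδ0] at hdm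
    push_cast
    linarith
  obtain ⟨Γ, hΓ, hcard⟩ := exists_isDeltaCover_card_le hd hGb hGm π hπ m.succ_pos hdk
  exact ⟨Γ, hΓ, hcard.trans_eq (by congr 1; omega)⟩
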